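/- Let $N\ge 2$ and $d_1,\dots,d_N\ge 1$ be integers, $\mathcal H=\mathbb C^{d_1}\otimes\cdots\otimes\mathbb C^{d_N}$ and $D=d_1\cdots d_N$. A splitting $A|B$ is an unordered partition of $\{1,\dots,N\}$ into two non-empty sets $A,B$; there are $2^{N-1}-1$ of them. Put $d_A=\prod_{i\in A}d_i$. For a unit vector $\psi\in\mathcal H$ let $\tau_{A|B}(\psi)=2\bigl(1-\mathrm{Tr}_A\bigl[(\mathrm{Tr}_B|\psi\rangle\langle\psi|)^2\bigr]\bigr)$ and let $\tau_1(\psi)=\frac{1}{2^{N-1}-1}\sum_{A|B}\tau_{A|B}(\psi)$ be the one-tangle. The entangling power of a $D\times D$ unitary matrix $U$ is $\varepsilon_\tau(U)=\langle\tau_1(U(\psi_1\otimes\cdots\otimes\psi_N))\rangle$, the average over independent $\psi_i$, each uniformly distributed on the unit sphere of $\mathbb C^{d_i}$. Let $\langle\varepsilon_\tau\rangle_{O(D)}$ and $\langle\varepsilon_\tau\rangle_{U(D)}$ be the averages of $\varepsilon_\tau$ over the real orthogonal group $O(D)$ and over the unitary group $U(D)$ with respect to the Haar probability measure. Put $$B=\sum_{i_1,\dots,i_N=0}^{1}d_1^{i_1}\cdots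 d_N^{i_N},\qquad C=\sum_{A|B}(d_A+d_B).$$ 1. If $D\ge 2$, then $$\langle\varepsilon_\tau\rangle_{O(D)}=2\left[1-\left(\prod_{i=1}^N\frac1{d_i+1}\right)\frac{2^N(D+1)-2B+\frac{BD-2^N}{2^{N-1}-1}\,C}{(D-1)(D+2)}\right].$$ 2. In all cases, $$\langle\varepsilon_\tau\rangle_{U(D)}=2\left[1-\left(\prod_{i=1}^N\frac1{d_i+1}\right)\frac{BC}{(2^{N-1}-1)(D+1)}\right].$$ 3. If $d_1=\dots=d_N=d\ge 2$, then $$\langle\varepsilon_\tau\rangle_{O(d^N)}=\frac{[2^N(d^N+1)-2(d+1)^N][d^N(d+1)^N-2^N]}{(2^{N-1}-1)(d^{2N}+d^N-2)(d+1)^N},\qquad \langle\varepsilon_\tau\rangle_{U(d^N)}=\frac{2^N(d^N+1)-2(d+1)^N}{(2^{N-1}-1)(d^N+1)}.$$ 4. For every fixed $d\ge 2$ both averages have the same limit: $$\lim_{N\to\infty}\langle\varepsilon_\tau\rangle_{O(d^N)}=\lim_{N\to\infty}\langle\varepsilon_\tau\rangle_{U(d^N)}=2.$$ -/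

import Mathlib

open MeasureTheory Filter Topology

namespace MultipartiteGates

noncomputable section

/-! ## Local systems, product states and reduced states -/

/-- Labels of the product basis of `ℂ^{d₁} ⊗ ⋯ ⊗ ℂ^{d_N}`. A vector of this tensor product is
represented by its coordinates, a function `BasisIndex d → ℂ`; a gate by its matrix. -/
abbrev BasisIndex {N : ℕ} (d : Fin N → ℕ) : Type := (i : Fin N) → Fin (d i)

/-- Labels of the product basis of the subsystem consisting of the factors in `A`. -/
abbrev SubIndex {N : ℕ} (d : Fin N → ℕ) (A : Finset (Fin N)) : Type :=
  (i : {i : Fin N // i ∈ A}) → Fin (d i)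

/-- The unit sphere of `ℂ^n`. -/
abbrev UnitSphere (n : ℕ) : Type := Metric.sphere (0 : EuclideanSpace ℂ (Fin n)) 1

/-- The uniform probability measure on the unit sphere of `ℂ^n`: the surface measure, normalized. -/
def uniformSphere (n : ℕ) : Measure (UnitSphere n) :=
  let σ : Measure (UnitSphere n) := (volume : Measure (EuclideanSpace ℂ (Fin n))).toSphere
  (σ Set.univ)⁻¹ • σ

/-- The product state `ψ₁ ⊗ ⋯ ⊗ ψ_N` of unit vectors, in coordinates. -/
def productState {N : ℕ} {d : Fin N → ℕ} (ψ : (i : Fin N) → UnitSphere (d i)) :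
    BasisIndex d → ℂ :=
  fun x => ∏ i, (ψ i : EuclideanSpace ℂ (Fin (d i))) (x i)

/-- The rank-one operator `|φ⟩⟨φ|`. -/
def densityMatrix {ι : Type*} (φ : ι → ℂ) : Matrix ι ι ℂ := Matrix.vecMulVec φ (star φ)

/-- The partial trace over all factors outside `A`; the result is an operator on the factors
in `A`. -/
def partialTraceCompl {N : ℕ} {d : Fin N → ℕ} (A : Finset (Fin N))
    (M : Matrix (BasisIndex d) (BasisIndex d) ℂ) : Matrix (SubIndex d A) (SubIndex d A) ℂ :=
  fun a a' => ∑ b : ((i : {i : Fin N // ¬ i ∈ A}) → Fin (d i)),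
    M ((Equiv.piEquivPiSubtypeProd (fun i => i ∈ A) (fun i => Fin (d i))).symm (a, b))
      ((Equiv.piEquivPiSubtypeProd (fun i => i ∈ A) (fun i => Fin (d i))).symm (a', b))

/-- The generalized concurrence `τ_{A|B}(φ) = 2 (1 - Tr_A (Tr_B |φ⟩⟨φ|)²)`, where `B` is the
complement of `A`. -/
def concurrence {N : ℕ} {d : Fin N → ℕ} (A : Finset (Fin N)) (φ : BasisIndex d → ℂ) : ℝ :=
  2 * (1 - (Matrix.trace ((partialTraceCompl A (densityMatrix φ)) ^ 2)).re)

/-- The unordered splittings `A|B` of the `N` subsystems into two non-empty parts. Each splitting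
is listed exactly once, by its part `A` that contains the first subsystem; `B` is `Aᶜ`. -/
def splittings (N : ℕ) : Finset (Finset (Fin N)) :=
  {A | (∃ i ∈ A, (i : ℕ) = 0) ∧ Aᶜ.Nonempty}

/-- The one-tangle: the average of the generalized concurrences over the `2^(N-1) - 1`
splittings. -/
def oneTangle {N : ℕ} {d : Fin N → ℕ} (φ : BasisIndex d → ℂ) : ℝ :=
  1 / ((2 : ℝ) ^ (N - 1) - 1) * ∑ A ∈ splittings N, concurrence A φ

/-- The entangling power of a gate for the one-tangle: the mean of `τ₁(U ψ)` over product states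
`ψ` whose factors are drawn independently and uniformly from the unit spheres. -/
def entanglingPower {N : ℕ} {d : Fin N → ℕ} (U : Matrix (BasisIndex d) (BasisIndex d) ℂ) : ℝ :=
  ∫ ψ, oneTangle (U.mulVec (productState ψ)) ∂(Measure.pi fun i => uniformSphere (d i))

/-! ## Haar averages over the orthogonal and the unitary group -/

section Haar

variable (n : Type*) [Fintype n] [DecidableEq n] (𝕜 : Type*) [RCLike 𝕜]

instance compactSpace_unitaryGroup : CompactSpace (Matrix.unitaryGroup n 𝕜) := by
  refine isCompact_iff_compactSpace.mp ?_
  have hK : IsCompact (Set.pi Set.univ fun _ : n => Set.pi Set.univ fun _ : n =>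
      Metric.closedBall (0 : 𝕜) 1) :=
    isCompact_univ_pi fun _ => isCompact_univ_pi fun _ => isCompact_closedBall _ _
  have hclosed : IsClosed {U : Matrix n n 𝕜 | star U * U = 1 ∧ U * star U = 1} := by
    refine IsClosed.inter ?_ ?_
    · exact isClosed_eq (continuous_star.mul continuous_id) continuous_const
    · exact isClosed_eq (continuous_id.mul continuous_star) continuous_const
  refine IsCompact.of_isClosed_subset (X := Matrix n n 𝕜) hK ?_ ?_
  · exact hclosed
  · intro U hU i _ j _
    simpa using entry_norm_bound_of_unitary (𝕜 := 𝕜) hU i j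

instance measurableSpace_unitaryGroup : MeasurableSpace (Matrix.unitaryGroup n 𝕜) := borel _

instance borelSpace_unitaryGroup : BorelSpace (Matrix.unitaryGroup n 𝕜) := ⟨rfl⟩

/-- The Haar probability measure on the group of unitary matrices over `𝕜`; for `𝕜 = ℝ` this
group is the orthogonal group. -/
def haarProb : Measure (Matrix.unitaryGroup n 𝕜) :=
  Measure.haarMeasure (⊤ : TopologicalSpace.PositiveCompacts (Matrix.unitaryGroup n 𝕜))

end Haar

/-- The average of the entangling power over the real orthogonal group `O(d₁⋯d_N)`. -/
def averageOrthogonal {N : ℕ} (d : Fin N → ℕ) : ℝ :=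
  ∫ O : Matrix.orthogonalGroup (BasisIndex d) ℝ,
    entanglingPower ((O : Matrix (BasisIndex d) (BasisIndex d) ℝ).map Complex.ofReal)
    ∂(haarProb (BasisIndex d) ℝ)

/-- The average of the entangling power over the unitary group `U(d₁⋯d_N)`. -/
def averageUnitary {N : ℕ} (d : Fin N → ℕ) : ℝ :=
  ∫ U : Matrix.unitaryGroup (BasisIndex d) ℂ,
    entanglingPower (U : Matrix (BasisIndex d) (BasisIndex d) ℂ)
    ∂(haarProb (BasisIndex d) ℂ)

/-! ## The auxiliary quantities of the formulas -/

/-- `B = ∑_{i₁,…,i_N ∈ {0,1}} d₁^{i₁} ⋯ d_N^{i_N}`. -/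
def auxB {N : ℕ} (d : Fin N → ℕ) : ℝ :=
  ∑ e : Fin N → Fin 2, ∏ k, (d k : ℝ) ^ (e k : ℕ)

/-- `C = ∑_{A|B} (d_A + d_B)`, where `d_A` is the dimension of the subsystem `A`. -/
def auxC {N : ℕ} (d : Fin N → ℕ) : ℝ :=
  ∑ A ∈ splittings N, ((∏ i ∈ A, (d i : ℝ)) + ∏ i ∈ Aᶜ, (d i : ℝ))

/-- `D = d₁ ⋯ d_N`. -/
def auxD {N : ℕ} (d : Fin N → ℕ) : ℝ := ∏ i, (d i : ℝ)

end

end MultipartiteGates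

/-! The purity of a reduced state is quartic in the state: it is a contraction of `φ a * φ b * conj
(φ c) * conj (φ e)`. For a fixed input `v` and a Haar random gate `U`, the mean of these monomials
at `φ = U v` is a tensor `T`, symmetric in its first two and in its last two indices and invariant
under the group. Such a tensor is `x δ_ab δ_ce + y (δ_ac δ_be + δ_ae δ_bc)` for the orthogonal group
(`orthogonal_invariant_form`), and `x = 0` for the unitary group, since a phase at one coordinate
changes the sign of the first pairing (`unitary_invariant_form`).

The coefficients follow from two contractions. One is the squared norm, equal to 1. The other is `s
= |∑ v_a²|²`, which real orthogonal gates preserve. So the orthogonal mean purity is affine in `s`,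
and only the mean of `s` over product states matters. This `s` is a product over the factors; each
factor has mean `2 / (d_i + 1)`, by the unitary form of the invariant tensor applied to the sphere
itself.

It remains to sum over splittings. A splitting pairs a subset with its complement, so `B = ∏ (d_i +
1)` and `C = B - 1 - D`, which makes the orthogonal numerator factor. For equal dimensions all terms
become geometric powers, which gives the limits. -/

namespace MultipartiteGates

open ComplexConjugate

/-! ### Tensors invariant under the orthogonal group -/

section InvariantTensor

variable {ι : Type*} [Fintype ι] [DecidableEq ι]

/-- Invariance of a tensor with two covariant and two contravariant indices under a matrix. -/
def TensorInvariant (T : ι → ι → ι → ι → ℂ) (M : Matrix ι ι ℂ) : Prop :=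
  ∀ a b c e, ∑ a', M a a' * ∑ b', M b b' * ∑ c', conj (M c c') * ∑ e', conj (M e e') *
    T a' b' c' e' = T a b c e

theorem TensorInvariant.diagonal {T : ι → ι → ι → ι → ℂ} {u : ι → ℂ}
    (h : TensorInvariant T (Matrix.diagonal u)) (a b c e : ι) :
    u a * (u b * (conj (u c) * (conj (u e) * T a b c e))) = T a b c e := by
  have := h a b c e
  simpa [Matrix.diagonal_apply, apply_ite conj] using this

theorem TensorInvariant.permutation {T : ι → ι → ι → ι → ℂ} {σ : Equiv.Perm ι}
    (h : TensorInvariant T ((1 : Matrix ι ι ℂ).submatrix σ id)) (a b c e : ι) :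
    T (σ a) (σ b) (σ c) (σ e) = T a b c e := by
  have := h a b c e
  simpa [Matrix.one_apply, apply_ite conj] using this

theorem sum_two_point {a b : ι} (hab : a ≠ b) (p q : ℂ) (f : ι → ℂ) :
    ∑ j, (if j = a then p else if j = b then q else 0) * f j = p * f a + q * f b := by
  rw [← Finset.sum_subset (Finset.subset_univ {a, b}), Finset.sum_pair hab]
  · simp [hab.symm]
  · intro j _ hj
    simp only [Finset.mem_insert, Finset.mem_singleton, not_or] at hj
    simp [hj.1, hj.2]

/-- Row `a` of `M` has only two nonzero entries, so invariance at `(a, a, a, a)` involves just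
sixteen entries of `T`. It links the diagonal entries to the pairings, which permutations and sign
changes cannot do. -/
theorem TensorInvariant.rotation {T : ι → ι → ι → ι → ℂ} {M : Matrix ι ι ℂ}
    (h : TensorInvariant T M) {a b : ι} (hab : a ≠ b) {p q : ℝ}
    (hM : ∀ j, M a j = if j = a then (p : ℂ) else if j = b then (q : ℂ) else 0) :
    p * (p * (p * (p * T a a a a + q * T a a a b) + q * (p * T a a b a + q * T a a b b)) +
        q * (p * (p * T a b a a + q * T a b a b) + q * (p * T a b b a + q * T a b b b))) +
      q * (p * (p * (p * T b a a a + q * T b a a b) + q * (p * T b a b a + q * T b a b b)) +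
        q * (p * (p * T b b a a + q * T b b a b) + q * (p * T b b b a + q * T b b b b)))
      = T a a a a := by
  have := h a a a a
  simpa only [hM, apply_ite conj, Complex.conj_ofReal, map_zero, sum_two_point hab] using this

theorem diagonal_sign_mem_orthogonalGroup {u : ι → ℝ} (hu : ∀ i, u i * u i = 1) :
    Matrix.diagonal u ∈ Matrix.orthogonalGroup ι ℝ := by
  rw [Matrix.mem_orthogonalGroup_iff]
  simp [hu]

theorem permutation_mem_orthogonalGroup (σ : Equiv.Perm ι) :
    (1 : Matrix ι ι ℝ).submatrix σ id ∈ Matrix.orthogonalGroup ι ℝ := by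
  rw [Matrix.mem_orthogonalGroup_iff]
  ext i j
  simp [Matrix.mul_apply, Matrix.one_apply]

theorem householder_mem_orthogonalGroup {w : ι → ℝ} {q : ℝ} (hw : w ⬝ᵥ w = q) (hq : q ≠ 0) :
    1 - (2 / q) • Matrix.vecMulVec w w ∈ Matrix.orthogonalGroup ι ℝ := by
  have h1 : Matrix.vecMulVec w w * Matrix.vecMulVec w w = q • Matrix.vecMulVec w w := by
    rw [Matrix.vecMulVec_mul_vecMulVec, hw]
    ext i j
    simp [Matrix.vecMulVec_apply]
    ring
  have h2 : (1 - (2 / q) • Matrix.vecMulVec w w).transpose = 1 - (2 / q) • Matrix.vecMulVec w w := by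
    ext i j
    simp [Matrix.vecMulVec_apply, Matrix.one_apply, eq_comm, mul_comm]
  rw [Matrix.mem_orthogonalGroup_iff, h2, mul_sub, sub_mul, sub_mul, smul_mul_smul_comm, h1,
    smul_smul, mul_one, one_mul, mul_one]
  have : 2 / q * (2 / q) * q = 2 / q + 2 / q := by field_simp; norm_num
  rw [this, add_smul]
  abel

theorem exists_perm_map_pair {κ : Type*} [DecidableEq κ] {a b a' b' : κ} (h : a ≠ b) (h' : a' ≠ b') :
    ∃ σ : Equiv.Perm κ, σ a = a' ∧ σ b = b' := by
  have h1 : Equiv.swap a a' b ≠ a' := by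
    intro hb
    apply h
    rw [← (Equiv.swap a a').injective.eq_iff, hb, Equiv.swap_apply_left]
  refine ⟨(Equiv.swap a a').trans (Equiv.swap (Equiv.swap a a' b) b'), ?_, ?_⟩
  · simp [Equiv.swap_apply_of_ne_of_ne h1.symm h']
  · simp

/-- A tensor invariant under the real orthogonal group that is symmetric in its first two and in
its last two indices is a combination of the pairings of indices. -/
theorem orthogonal_invariant_form {T : ι → ι → ι → ι → ℂ}
    (hT : ∀ R ∈ Matrix.orthogonalGroup ι ℝ, TensorInvariant T (R.map Complex.ofReal))
    (hab : ∀ a b c e, T a b c e = T b a c e) (hce : ∀ a b c e, T a b c e = T a b e c)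
    {i₀ j₀ : ι} (h₀ : i₀ ≠ j₀) (a b c e : ι) :
    T a b c e = T i₀ i₀ j₀ j₀ * (if a = b ∧ c = e then 1 else 0) +
      T i₀ j₀ i₀ j₀ * ((if a = c ∧ b = e then 1 else 0) + if a = e ∧ b = c then 1 else 0) := by
  -- Permutation matrices make an entry depend only on which of its indices coincide;
  -- two-transitivity then moves every pair of distinct indices to `i₀, j₀`.
  have hperm (σ : Equiv.Perm ι) (a b c e : ι) : T (σ a) (σ b) (σ c) (σ e) = T a b c e := by
    apply TensorInvariant.permutation
    convert hT _ (permutation_mem_orthogonalGroup σ)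
    ext i j
    simp [Matrix.one_apply, apply_ite Complex.ofReal]
  have hx (a b : ι) (h : a ≠ b) : T a a b b = T i₀ i₀ j₀ j₀ := by
    obtain ⟨σ, rfl, rfl⟩ := exists_perm_map_pair h₀ h
    exact hperm σ _ _ _ _
  have hy (a b : ι) (h : a ≠ b) : T a b a b = T i₀ j₀ i₀ j₀ := by
    obtain ⟨σ, rfl, rfl⟩ := exists_perm_map_pair h₀ h
    exact hperm σ _ _ _ _
  have hy' (a b : ι) (h : a ≠ b) : T a b b a = T i₀ j₀ i₀ j₀ := by rw [hce, hy a b h]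
  have hsign (i a b c e : ι) : (if a = i then -1 else 1) * ((if b = i then -1 else 1) *
      ((if c = i then -1 else 1) * ((if e = i then -1 else 1) * T a b c e))) = T a b c e := by
    have h1 : TensorInvariant T (Matrix.diagonal fun j => if j = i then (-1 : ℂ) else 1) := by
      convert hT _ (diagonal_sign_mem_orthogonalGroup
        (u := fun j => if j = i then (-1 : ℝ) else 1) (fun j => by split_ifs <;> norm_num))
      ext j k
      by_cases hjk : j = k
      · subst hjk; by_cases hj : j = i <;> simp [hj]
      · simp [hjk]
    simpa [apply_ite conj] using h1.diagonal a b c e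
  -- The reflection in `w = e_a + 2 e_b`, with `w ⬝ᵥ w = 5`, has row `a` equal to `(3/5, -4/5)` on
  -- `a, b`. As `p² + q² = 1`, both `1 - p⁴ - q⁴` and the coefficient of `x + 2y` are `2p²q² =
  -- 288/625`, which forces `T a a a a = x + 2y`.
  have hw (a b : ι) (h : a ≠ b) : T a a a a = T i₀ i₀ j₀ j₀ + 2 * T i₀ j₀ i₀ j₀ := by
    have hq : (fun j => if j = a then (1 : ℝ) else if j = b then 2 else 0) ⬝ᵥ
        (fun j => if j = a then (1 : ℝ) else if j = b then 2 else 0) = 5 := by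
      rw [dotProduct, ← Finset.sum_subset (Finset.subset_univ {a, b}), Finset.sum_pair h]
      · simp [h.symm]; norm_num
      · intro j _ hj
        simp only [Finset.mem_insert, Finset.mem_singleton, not_or] at hj
        simp [hj.1, hj.2]
    have h1 := (hT _ (householder_mem_orthogonalGroup hq (by norm_num))).rotation h
      (p := 3 / 5) (q := -(4 / 5)) (by
        intro j
        by_cases hj : j = a
        · subst hj; simp [Matrix.vecMulVec_apply]; norm_num
        · by_cases hj' : j = b
          · subst hj'; simp [Matrix.vecMulVec_apply, h.symm, h]; norm_num
          · simp [Matrix.vecMulVec_apply, hj, hj', Ne.symm hj])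
    have o1 : T a a a b = 0 := by
      have := hsign b a a a b; simp [h] at this; linear_combination (-1 / 2) * this
    have o2 : T a a b a = 0 := by rw [hce, o1]
    have o3 : T a b a a = 0 := by
      have := hsign b a b a a; simp [h] at this; linear_combination (-1 / 2) * this
    have o4 : T b a a a = 0 := by rw [hab, o3]
    have o5 : T b b b a = 0 := by
      have := hsign a b b b a; simp [h.symm] at this; linear_combination (-1 / 2) * this
    have o6 : T b b a b = 0 := by rw [hce, o5]
    have o7 : T b a b b = 0 := by
      have := hsign a b a b b; simp [h.symm] at this; linear_combination (-1 / 2) * this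
    have o8 : T a b b b = 0 := by rw [hab, o7]
    have o9 : T b b b b = T a a a a := by
      simpa using hperm (Equiv.swap a b) a a a a
    rw [o1, o2, o3, o4, o5, o6, o7, o8, o9, hx a b h, hx b a h.symm, hy a b h, hy' a b h,
      hy b a h.symm, hy' b a h.symm] at h1
    push_cast at h1
    linear_combination (-625 / 288) * h1
  have hw' (a : ι) : T a a a a = T i₀ i₀ j₀ j₀ + 2 * T i₀ j₀ i₀ j₀ := by
    by_cases ha : a = i₀
    · exact hw a j₀ (ha ▸ h₀)
    · exact hw a i₀ ha
  -- Outside the three pairings some index value occurs exactly once; changing the sign of that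
  -- coordinate gives `T = -T`.
  by_cases h1 : a = b
  · subst h1
    by_cases h2 : c = e
    · subst h2
      by_cases h3 : a = c
      · subst h3; rw [hw']; simp; ring
      · rw [hx a c h3]; simp [h3]
    · have : T a a c e = 0 := by
        by_cases h3 : c = a
        · subst h3
          have := hsign e c c c e; simp [h2] at this; linear_combination (-1 / 2) * this
        · have := hsign c a a c e
          simp [Ne.symm h2, Ne.symm h3] at this; linear_combination (-1 / 2) * this
      rw [this]
      have h4 : ¬ (a = c ∧ a = e) := fun h => h2 (h.1.symm.trans h.2)
      have h5 : ¬ (a = e ∧ a = c) := fun h => h4 h.symm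
      simp [h2, h4, h5]
  · by_cases h3 : a = c
    · subst h3
      by_cases h4 : b = e
      · subst h4; rw [hy a b h1]; simp [h1]
      · have : T a b a e = 0 := by
          have := hsign b a b a e
          simp [h1, Ne.symm h4] at this; linear_combination (-1 / 2) * this
        rw [this]; simp [h1, h4, Ne.symm h1]
    · by_cases h4 : a = e
      · subst h4
        by_cases h5 : b = c
        · subst h5; rw [hy' a b h1]; simp [h1]
        · have : T a b c a = 0 := by
            have := hsign b a b c a
            simp [h1, Ne.symm h5] at this; linear_combination (-1 / 2) * this
          rw [this]; simp [h1, h5, h3]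
      · have : T a b c e = 0 := by
          have := hsign a a b c e
          simp [Ne.symm h1, Ne.symm h3, Ne.symm h4] at this; linear_combination (-1 / 2) * this
        rw [this]; simp [h1, h3, h4]

end InvariantTensor

end MultipartiteGates

namespace MultipartiteGates

open ComplexConjugate

/-! ### Contractions that determine the coefficients -/

section Contractions

variable {ι : Type*} [Fintype ι] [DecidableEq ι]

/-- A combination of the three pairings of four indices. -/
def IsPairing (T : ι → ι → ι → ι → ℂ) (x y : ℂ) : Prop :=
  ∀ a b c e, T a b c e = x * (if a = b ∧ c = e then 1 else 0) +
    y * ((if a = c ∧ b = e then 1 else 0) + if a = e ∧ b = c then 1 else 0)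

theorem IsPairing.sum_self {T : ι → ι → ι → ι → ℂ} {x y : ℂ} (h : IsPairing T x y) :
    ∑ a, ∑ b, T a b a b = Fintype.card ι * x + y * (Fintype.card ι ^ 2 + Fintype.card ι) := by
  have (a b : ι) : (a = b ∧ b = a) ↔ a = b := ⟨fun h => h.1, fun h => ⟨h, h.symm⟩⟩
  simp [h _ _ _ _, Finset.sum_add_distrib, ← Finset.mul_sum, this]
  ring

theorem IsPairing.sum_cross {T : ι → ι → ι → ι → ℂ} {x y : ℂ} (h : IsPairing T x y) :
    ∑ a, ∑ c, T a a c c = Fintype.card ι ^ 2 * x + 2 * y * Fintype.card ι := by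
  simp [h _ _ _ _, Finset.sum_add_distrib, ← Finset.mul_sum]
  ring

/-- The first pairing forces `a = a'` and `b = b'`, leaving `|α||β|` terms. The other two force only
`a = a'` or only `b = b'`, leaving `|α||β|²` and `|α|²|β|` terms. -/
theorem IsPairing.sum_bipartite {T : ι → ι → ι → ι → ℂ} {x y : ℂ} (h : IsPairing T x y)
    {α β : Type*} [Fintype α] [Fintype β] (f : α × β ≃ ι) :
    ∑ a, ∑ a', ∑ b, ∑ b', T (f (a, b)) (f (a', b')) (f (a', b)) (f (a, b')) =
    Fintype.card ι * (x + y * (Fintype.card α + Fintype.card β)) := by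
  classical
  have hT (a a' : α) (b b' : β) : T (f (a, b)) (f (a', b')) (f (a', b)) (f (a, b')) =
      x * (if a = a' then if b = b' then 1 else 0 else 0) +
        y * ((if a = a' then 1 else 0) + if b = b' then 1 else 0) := by
    rw [h]
    simp only [f.injective.eq_iff, Prod.mk.injEq, eq_comm (a := a') (b := a),
      eq_comm (a := b') (b := b)]
    by_cases h1 : a = a' <;> by_cases h2 : b = b' <;> simp [h1, h2]
  have hcard : (Fintype.card ι : ℂ) = Fintype.card α * Fintype.card β := by
    rw [← Fintype.card_congr f, Fintype.card_prod, Nat.cast_mul]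
  simp [hT, Finset.sum_add_distrib, ← Finset.mul_sum, hcard]
  ring

omit [DecidableEq ι] in
theorem card_ne_one_of_ne {i j : ι} (h : i ≠ j) : (Fintype.card ι : ℂ) - 1 ≠ 0 := by
  have : 1 < Fintype.card ι := Fintype.one_lt_card_iff.mpr ⟨i, j, h⟩
  rw [sub_ne_zero]
  exact_mod_cast this.ne'

omit [DecidableEq ι] in
theorem card_add_two_ne_zero : (Fintype.card ι : ℂ) + 2 ≠ 0 := by
  exact_mod_cast (Nat.succ_ne_zero (Fintype.card ι + 1))

omit [DecidableEq ι] in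
theorem card_add_one_ne_zero : (Fintype.card ι : ℂ) + 1 ≠ 0 := by
  exact_mod_cast (Nat.succ_ne_zero (Fintype.card ι))

omit [DecidableEq ι] in
theorem card_ne_zero_of_mem (i : ι) : (Fintype.card ι : ℂ) ≠ 0 := by
  have : Nonempty ι := ⟨i⟩
  exact_mod_cast Fintype.card_ne_zero

/-- The bipartite contraction of an orthogonally invariant tensor. -/
theorem orthogonal_invariant_bipartite {T : ι → ι → ι → ι → ℂ}
    (hT : ∀ R ∈ Matrix.orthogonalGroup ι ℝ, TensorInvariant T (R.map Complex.ofReal))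
    (hab : ∀ a b c e, T a b c e = T b a c e) (hce : ∀ a b c e, T a b c e = T a b e c)
    (hone : ∑ a, ∑ b, T a b a b = 1) {s : ℂ} (hs : ∑ a, ∑ c, T a a c c = s)
    (hcard : 2 ≤ Fintype.card ι)
    {α β : Type*} [Fintype α] [Fintype β] (f : α × β ≃ ι) :
    ∑ a, ∑ a', ∑ b, ∑ b', T (f (a, b)) (f (a', b')) (f (a', b)) (f (a, b')) =
      (s * (Fintype.card ι + 1) - 2 + (Fintype.card ι - s) * (Fintype.card α + Fintype.card β)) /
        ((Fintype.card ι - 1) * (Fintype.card ι + 2)) := by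
  classical
  obtain ⟨i₀, j₀, h₀⟩ := Fintype.one_lt_card_iff.mp hcard
  have hform : IsPairing T _ _ := orthogonal_invariant_form hT hab hce h₀
  have n0 := card_ne_zero_of_mem i₀
  have n1 := card_ne_one_of_ne h₀
  have n2 := card_add_two_ne_zero (ι := ι)
  set x := T i₀ i₀ j₀ j₀
  set y := T i₀ j₀ i₀ j₀
  rw [hform.sum_self] at hone
  rw [hform.sum_cross] at hs
  rw [hform.sum_bipartite, eq_div_iff (mul_ne_zero n1 n2), ← hs]
  -- With `s` already expressed through `x` and `y`, the two sides differ by a multiple of the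
  -- normalization.
  linear_combination ((Fintype.card ι : ℂ) * (Fintype.card α + Fintype.card β) - 2) * hone

/-- A unitarily invariant tensor is a multiple of the sum of the two pairings of covariant with
contravariant indices. -/
theorem unitary_invariant_form {T : ι → ι → ι → ι → ℂ}
    (hT : ∀ U ∈ Matrix.unitaryGroup ι ℂ, TensorInvariant T U)
    (hab : ∀ a b c e, T a b c e = T b a c e) (hce : ∀ a b c e, T a b c e = T a b e c)
    (hone : ∑ a, ∑ b, T a b a b = 1) :
    IsPairing T 0 (1 / (Fintype.card ι * (Fintype.card ι + 1))) := by
  intro a b c e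
  have n0 := card_ne_zero_of_mem a
  have n1 := card_add_one_ne_zero (ι := ι)
  -- With a single index all pairings coincide and the claim is `1 = (1/2) * (1 + 1)`; the
  -- orthogonal form needs two distinct indices.
  rcases subsingleton_or_nontrivial ι with hι | hι
  · have hu (i : ι) : i = a := Subsingleton.elim _ _
    have hc : Fintype.card ι = 1 := Fintype.card_eq_one_iff.mpr ⟨a, hu⟩
    have huniv : (Finset.univ : Finset ι) = {a} := by ext i; simp [hu i]
    rw [huniv, Finset.sum_singleton, Finset.sum_singleton] at hone
    rw [hu b, hu c, hu e, hone, hc]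
    norm_num
  · obtain ⟨i₀, j₀, h₀⟩ := exists_pair_ne ι
    have hO : ∀ R ∈ Matrix.orthogonalGroup ι ℝ, TensorInvariant T (R.map Complex.ofReal) := by
      intro R hR
      apply hT
      rw [Matrix.mem_orthogonalGroup_iff] at hR
      rw [Matrix.mem_unitaryGroup_iff]
      have := congrArg (fun M : Matrix ι ι ℝ => M.map Complex.ofReal) hR
      ext i j
      have := congrFun (congrFun this i) j
      simp only [Matrix.map_apply, Matrix.mul_apply, Matrix.transpose_apply] at this
      simp only [Matrix.mul_apply, Matrix.star_apply, Matrix.map_apply]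
      rw [show (1 : Matrix ι ι ℂ) i j = Complex.ofReal ((1 : Matrix ι ι ℝ) i j) by
        simp [Matrix.one_apply, apply_ite Complex.ofReal], ← this]
      push_cast
      simp
    have hform : IsPairing T _ _ := orthogonal_invariant_form hO hab hce h₀
    have hx : T i₀ i₀ j₀ j₀ = 0 := by
      -- The phase `I` at `i₀` multiplies `T i₀ i₀ j₀ j₀` by `I² = -1`.
      have hU : Matrix.diagonal (fun j => if j = i₀ then Complex.I else 1) ∈
          Matrix.unitaryGroup ι ℂ := by
        rw [Matrix.mem_unitaryGroup_iff, Matrix.star_eq_conjTranspose,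
          Matrix.diagonal_conjTranspose, Matrix.diagonal_mul_diagonal, ← Matrix.diagonal_one]
        congr 1
        ext j
        by_cases hj : j = i₀ <;> simp [hj]
      have := (hT _ hU).diagonal i₀ i₀ j₀ j₀
      simp only [if_true, h₀.symm, if_false, map_one, one_mul] at this
      rw [← mul_assoc, Complex.I_mul_I] at this
      linear_combination (-1 / 2) * this
    rw [hx] at hform
    rw [hform.sum_self] at hone
    rw [hform a b c e]
    congr 2
    rw [eq_div_iff (mul_ne_zero n0 n1)]
    linear_combination hone

theorem unitary_invariant_cross {T : ι → ι → ι → ι → ℂ}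
    (hT : ∀ U ∈ Matrix.unitaryGroup ι ℂ, TensorInvariant T U)
    (hab : ∀ a b c e, T a b c e = T b a c e) (hce : ∀ a b c e, T a b c e = T a b e c)
    (hone : ∑ a, ∑ b, T a b a b = 1) [Nonempty ι] :
    ∑ a, ∑ c, T a a c c = 2 / (Fintype.card ι + 1) := by
  obtain ⟨i⟩ := ‹Nonempty ι›
  have n0 := card_ne_zero_of_mem i
  have n1 := card_add_one_ne_zero (ι := ι)
  rw [(unitary_invariant_form hT hab hce hone).sum_cross]
  field_simp
  ring

theorem unitary_invariant_bipartite {T : ι → ι → ι → ι → ℂ}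
    (hT : ∀ U ∈ Matrix.unitaryGroup ι ℂ, TensorInvariant T U)
    (hab : ∀ a b c e, T a b c e = T b a c e) (hce : ∀ a b c e, T a b c e = T a b e c)
    (hone : ∑ a, ∑ b, T a b a b = 1) [Nonempty ι]
    {α β : Type*} [Fintype α] [Fintype β] (f : α × β ≃ ι) :
    ∑ a, ∑ a', ∑ b, ∑ b', T (f (a, b)) (f (a', b')) (f (a', b)) (f (a, b')) =
      (Fintype.card α + Fintype.card β) / (Fintype.card ι + 1) := by
  classical
  obtain ⟨i⟩ := ‹Nonempty ι›
  have n0 := card_ne_zero_of_mem i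
  have n1 := card_add_one_ne_zero (ι := ι)
  rw [(unitary_invariant_form hT hab hce hone).sum_bipartite]
  field_simp
  ring

end Contractions

end MultipartiteGates

namespace MultipartiteGates

open ComplexConjugate

/-! ### Fourth moments of a random vector -/

section Moments

variable {ι : Type*} [Fintype ι]

/-- The quartic monomials in a complex vector and its conjugate. -/
def quartic (v : ι → ℂ) (a b c e : ι) : ℂ := v a * v b * conj (v c) * conj (v e)

/-- The sums are nested as in `TensorInvariant`, and are collapsed from the innermost outwards. -/
theorem quartic_mulVec (M : Matrix ι ι ℂ) (v : ι → ℂ) (a b c e : ι) :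
    quartic (M.mulVec v) a b c e = ∑ a', M a a' * ∑ b', M b b' * ∑ c', conj (M c c') *
      ∑ e', conj (M e e') * quartic v a' b' c' e' := by
  have (a' b' c' : ι) : ∑ e', conj (M e e') * quartic v a' b' c' e' =
      v a' * v b' * conj (v c') * conj (M.mulVec v e) := by
    simp only [quartic, Matrix.mulVec, dotProduct, map_sum, map_mul, Finset.mul_sum]
    exact Finset.sum_congr rfl fun _ _ => by ring
  simp only [this]
  have (a' b' : ι) : ∑ c', conj (M c c') * (v a' * v b' * conj (v c') * conj (M.mulVec v e)) =
      v a' * v b' * conj (M.mulVec v c) * conj (M.mulVec v e) := by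
    conv_rhs => rw [Matrix.mulVec, dotProduct, map_sum, Finset.mul_sum, Finset.sum_mul]
    exact Finset.sum_congr rfl fun _ _ => by rw [map_mul]; ring
  simp only [this]
  have (a' : ι) : ∑ b', M b b' * (v a' * v b' * conj (M.mulVec v c) * conj (M.mulVec v e)) =
      v a' * M.mulVec v b * conj (M.mulVec v c) * conj (M.mulVec v e) := by
    conv_rhs => rw [Matrix.mulVec, dotProduct, Finset.mul_sum, Finset.sum_mul, Finset.sum_mul]
    exact Finset.sum_congr rfl fun _ _ => by ring
  simp only [this]
  conv_lhs => rw [quartic, Matrix.mulVec, dotProduct, Finset.sum_mul, Finset.sum_mul,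
    Finset.sum_mul]
  exact Finset.sum_congr rfl fun _ _ => by ring

theorem sum_quartic_self (v : ι → ℂ) :
    ∑ a, ∑ b, quartic v a b a b = ((∑ a, Complex.normSq (v a) : ℝ) : ℂ) ^ 2 := by
  rw [sq, Complex.ofReal_sum, Finset.sum_mul_sum]
  refine Finset.sum_congr rfl fun a _ => Finset.sum_congr rfl fun b _ => ?_
  rw [← Complex.mul_conj, ← Complex.mul_conj, quartic]
  ring

/-- This contraction sees the bilinear form `∑ v_a²`, an invariant of real orthogonal but not of
unitary gates; it is where the two averages differ. -/
theorem sum_quartic_cross (v : ι → ℂ) :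
    ∑ a, ∑ c, quartic v a a c c = (Complex.normSq (∑ a, v a ^ 2) : ℂ) := by
  rw [← Complex.mul_conj, map_sum, Finset.sum_mul_sum]
  refine Finset.sum_congr rfl fun a _ => Finset.sum_congr rfl fun b _ => ?_
  rw [quartic, map_pow]
  ring

omit [Fintype ι] in
theorem continuous_quartic (a b c e : ι) : Continuous fun v : ι → ℂ => quartic v a b c e := by
  unfold quartic
  fun_prop

variable {Ω : Type*} [MeasurableSpace Ω] (μ : Measure Ω) (φ : Ω → ι → ℂ)

/-- The mean of the quartic monomials of a random vector. -/
noncomputable def momentTensor (a b c e : ι) : ℂ := ∫ ω, quartic (φ ω) a b c e ∂μ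

omit [Fintype ι] in
theorem momentTensor_swap_left (a b c e : ι) :
    momentTensor μ φ a b c e = momentTensor μ φ b a c e := by
  simp only [momentTensor, quartic, mul_comm (φ _ a)]

omit [Fintype ι] in
theorem momentTensor_swap_right (a b c e : ι) :
    momentTensor μ φ a b c e = momentTensor μ φ a b e c := by
  simp only [momentTensor, quartic, mul_assoc, mul_comm (conj (φ _ c))]

variable {μ φ}

/-- By multilinearity, the integral is moved inside the nested sums one level at a time. -/
theorem tensorInvariant_momentTensor (hint : ∀ a b c e, Integrable (fun ω => quartic (φ ω) a b c e) μ)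
    {M : Matrix ι ι ℂ}
    (hM : ∀ a b c e, ∫ ω, quartic (M.mulVec (φ ω)) a b c e ∂μ = ∫ ω, quartic (φ ω) a b c e ∂μ) :
    TensorInvariant (momentTensor μ φ) M := by
  intro a b c e
  have h1 (a b c : ι) : Integrable (fun ω => ∑ e', conj (M e e') * quartic (φ ω) a b c e') μ :=
    integrable_finsetSum _ fun _ _ => (hint _ _ _ _).const_mul _
  have h2 (a b : ι) : Integrable (fun ω => ∑ c', conj (M c c') *
      ∑ e', conj (M e e') * quartic (φ ω) a b c' e') μ :=
    integrable_finsetSum _ fun _ _ => (h1 _ _ _).const_mul _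
  have h3 (a : ι) : Integrable (fun ω => ∑ b', M b b' * ∑ c', conj (M c c') *
      ∑ e', conj (M e e') * quartic (φ ω) a b' c' e') μ :=
    integrable_finsetSum _ fun _ _ => (h2 _ _).const_mul _
  rw [momentTensor, ← hM]
  simp only [quartic_mulVec]
  rw [integral_finsetSum _ fun _ _ => (h3 _).const_mul _]
  refine Finset.sum_congr rfl fun a' _ => ?_
  rw [integral_const_mul, integral_finsetSum _ fun _ _ => (h2 _ _).const_mul _]
  congr 1
  refine Finset.sum_congr rfl fun b' _ => ?_
  rw [integral_const_mul, integral_finsetSum _ fun _ _ => (h1 _ _ _).const_mul _]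
  congr 1
  refine Finset.sum_congr rfl fun c' _ => ?_
  rw [integral_const_mul, integral_finsetSum _ fun _ _ => (hint _ _ _ _).const_mul _]
  congr 1
  refine Finset.sum_congr rfl fun e' _ => ?_
  rw [integral_const_mul, momentTensor]

theorem sum_momentTensor_self [IsProbabilityMeasure μ]
    (hint : ∀ a b c e, Integrable (fun ω => quartic (φ ω) a b c e) μ)
    (hone : ∀ ω, ∑ a, Complex.normSq (φ ω a) = 1) :
    ∑ a, ∑ b, momentTensor μ φ a b a b = 1 := by
  simp only [momentTensor]
  simp only [← integral_finsetSum _ fun _ _ => hint _ _ _ _]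
  rw [← integral_finsetSum _ fun _ _ => integrable_finsetSum _ fun _ _ => hint _ _ _ _]
  simp [sum_quartic_self, hone]

theorem sum_momentTensor_cross
    (hint : ∀ a b c e, Integrable (fun ω => quartic (φ ω) a b c e) μ) :
    ∑ a, ∑ c, momentTensor μ φ a a c c =
      ((∫ ω, Complex.normSq (∑ a, φ ω a ^ 2) ∂μ : ℝ) : ℂ) := by
  simp only [momentTensor]
  simp only [← integral_finsetSum _ fun _ _ => hint _ _ _ _]
  rw [← integral_finsetSum _ fun _ _ => integrable_finsetSum _ fun _ _ => hint _ _ _ _,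
    ← integral_complex_ofReal]
  simp only [sum_quartic_cross]

omit [Fintype ι] in
theorem integral_sum_quartic_bipartite
    (hint : ∀ a b c e, Integrable (fun ω => quartic (φ ω) a b c e) μ)
    {α β : Type*} [Fintype α] [Fintype β] (f : α × β ≃ ι) :
    ∫ ω, ∑ a, ∑ a', ∑ b, ∑ b',
      quartic (φ ω) (f (a, b)) (f (a', b')) (f (a', b)) (f (a, b')) ∂μ =
    ∑ a, ∑ a', ∑ b, ∑ b',
      momentTensor μ φ (f (a, b)) (f (a', b')) (f (a', b)) (f (a, b')) := by
  rw [integral_finsetSum _ fun _ _ => integrable_finsetSum _ fun _ _ => integrable_finsetSum _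
    fun _ _ => integrable_finsetSum _ fun _ _ => hint _ _ _ _]
  refine Finset.sum_congr rfl fun _ _ => ?_
  rw [integral_finsetSum _ fun _ _ => integrable_finsetSum _
    fun _ _ => integrable_finsetSum _ fun _ _ => hint _ _ _ _]
  refine Finset.sum_congr rfl fun _ _ => ?_
  rw [integral_finsetSum _ fun _ _ => integrable_finsetSum _ fun _ _ => hint _ _ _ _]
  refine Finset.sum_congr rfl fun _ _ => ?_
  rw [integral_finsetSum _ fun _ _ => hint _ _ _ _]
  rfl

end Moments

/-! ### Purity as a contraction of fourth moments -/

section Purity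

variable {N : ℕ} {d : Fin N → ℕ}

/-- The purity of the reduced state on the subsystem `A`. -/
noncomputable def purity (A : Finset (Fin N)) (φ : BasisIndex d → ℂ) : ℝ :=
  (Matrix.trace ((partialTraceCompl A (densityMatrix φ)) ^ 2)).re

/-- Coordinates of a bipartition of the product basis. -/
def splitEquiv (d : Fin N → ℕ) (A : Finset (Fin N)) :
    SubIndex d A × ((i : {i : Fin N // ¬ i ∈ A}) → Fin (d i)) ≃ BasisIndex d :=
  (Equiv.piEquivPiSubtypeProd (fun i => i ∈ A) (fun i => Fin (d i))).symm

theorem trace_partialTraceCompl_sq (A : Finset (Fin N)) (φ : BasisIndex d → ℂ) :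
    Matrix.trace ((partialTraceCompl A (densityMatrix φ)) ^ 2) = ∑ a, ∑ a', ∑ b, ∑ b',
      quartic φ (splitEquiv d A (a, b)) (splitEquiv d A (a', b')) (splitEquiv d A (a', b))
        (splitEquiv d A (a, b')) := by
  rw [sq, Matrix.trace]
  refine Finset.sum_congr rfl fun a _ => ?_
  rw [Matrix.diag_apply, Matrix.mul_apply]
  refine Finset.sum_congr rfl fun a' _ => ?_
  rw [partialTraceCompl, partialTraceCompl, Finset.sum_mul_sum]
  refine Finset.sum_congr rfl fun b _ => Finset.sum_congr rfl fun b' _ => ?_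
  simp only [densityMatrix, Matrix.vecMulVec_apply, quartic, splitEquiv, Pi.star_apply,
    RCLike.star_def]
  ring

theorem continuous_purity (A : Finset (Fin N)) :
    Continuous fun φ : BasisIndex d → ℂ => purity A φ := by
  simp only [purity, trace_partialTraceCompl_sq]
  refine Complex.continuous_re.comp ?_
  refine continuous_finsetSum _ fun _ _ => continuous_finsetSum _ fun _ _ =>
    continuous_finsetSum _ fun _ _ => continuous_finsetSum _ fun _ _ => continuous_quartic _ _ _ _

theorem concurrence_eq (A : Finset (Fin N)) (φ : BasisIndex d → ℂ) :
    concurrence A φ = 2 * (1 - purity A φ) := rfl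

theorem integral_purity {Ω : Type*} [MeasurableSpace Ω] {μ : Measure Ω}
    {φ : Ω → BasisIndex d → ℂ}
    (hint : ∀ a b c e, Integrable (fun ω => quartic (φ ω) a b c e) μ) (A : Finset (Fin N)) :
    ∫ ω, purity A (φ ω) ∂μ = (∑ a, ∑ a', ∑ b, ∑ b',
      momentTensor μ φ (splitEquiv d A (a, b)) (splitEquiv d A (a', b')) (splitEquiv d A (a', b))
        (splitEquiv d A (a, b'))).re := by
  rw [← integral_sum_quartic_bipartite hint]
  simp only [purity, trace_partialTraceCompl_sq]
  refine integral_re (𝕜 := ℂ) ?_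
  exact integrable_finsetSum _ fun _ _ => integrable_finsetSum _ fun _ _ => integrable_finsetSum _
    fun _ _ => integrable_finsetSum _ fun _ _ => hint _ _ _ _

theorem card_basisIndex (d : Fin N → ℕ) : (Fintype.card (BasisIndex d) : ℝ) = auxD d := by
  simp [auxD]

theorem card_subIndex (d : Fin N → ℕ) (A : Finset (Fin N)) :
    (Fintype.card (SubIndex d A) : ℝ) = ∏ i ∈ A, (d i : ℝ) := by
  rw [Fintype.card_pi]
  push_cast
  simp only [Fintype.card_fin]
  exact Finset.prod_coe_sort A fun i => (d i : ℝ)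

theorem card_subIndex_compl (d : Fin N → ℕ) (A : Finset (Fin N)) :
    (Fintype.card ((i : {i : Fin N // ¬ i ∈ A}) → Fin (d i)) : ℝ) = ∏ i ∈ Aᶜ, (d i : ℝ) := by
  rw [Fintype.card_pi]
  push_cast
  simp only [Fintype.card_fin]
  exact (Finset.prod_subtype _ (by simp) fun i => (d i : ℝ)).symm

end Purity

end MultipartiteGates

namespace MultipartiteGates

open ComplexConjugate Pointwise

/-! ### Isometry invariance of the sphere measure -/

section SphereMeasure

variable {E : Type*} [NormedAddCommGroup E] [NormedSpace ℝ E]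

/-- The action of a linear isometry on the unit sphere. -/
def sphereMap (L : E ≃ₗᵢ[ℝ] E) (x : Metric.sphere (0 : E) 1) : Metric.sphere (0 : E) 1 :=
  ⟨L x, by simp⟩

theorem continuous_sphereMap (L : E ≃ₗᵢ[ℝ] E) : Continuous (sphereMap L) :=
  (L.continuous.comp continuous_subtype_val).subtype_mk _

/-- Up to a constant, the measure of `s` is the volume of the cone `(0, 1) • s`, and a linear
isometry commutes with forming cones. -/
theorem map_toSphere [MeasurableSpace E] [BorelSpace E] {μ : Measure E} {L : E ≃ₗᵢ[ℝ] E}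
    (hL : MeasurePreserving L μ μ) : μ.toSphere.map (sphereMap L) = μ.toSphere := by
  have hm : Measurable (sphereMap L) := (continuous_sphereMap L).measurable
  ext s hs
  rw [Measure.map_apply hm hs, Measure.toSphere_apply' _ (hm hs), Measure.toSphere_apply' _ hs]
  congr 1
  have : Set.Ioo (0 : ℝ) 1 • (Subtype.val '' (sphereMap L ⁻¹' s)) =
      L ⁻¹' (Set.Ioo (0 : ℝ) 1 • (Subtype.val '' s)) := by
    ext x
    simp only [Set.mem_smul, Set.mem_preimage]
    constructor
    · rintro ⟨r, hr, _, ⟨y, hy, rfl⟩, rfl⟩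
      exact ⟨r, hr, _, ⟨_, hy, rfl⟩, by simp [sphereMap]⟩
    · rintro ⟨r, hr, _, ⟨y, hy, rfl⟩, hx⟩
      refine ⟨r, hr, _, ⟨sphereMap L.symm y, ?_, rfl⟩, ?_⟩
      · have : sphereMap L (sphereMap L.symm y) = y := by ext1; simp [sphereMap]
        simpa [this] using hy
      · apply L.injective
        rw [← hx]
        simp [sphereMap]
  rw [this]
  exact hL.measure_preimage_equiv (f := L.toHomeomorph.toMeasurableEquiv) _

end SphereMeasure

/-! ### Uniform unit vectors -/

section UniformSphere

/-- Finiteness holds even for `n = 0`, where the sphere is empty and the measure zero; total mass 1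
needs `1 ≤ n`. -/
instance isFiniteMeasure_uniformSphere (n : ℕ) : IsFiniteMeasure (uniformSphere n) := by
  unfold uniformSphere
  constructor
  simp only [Measure.smul_apply, smul_eq_mul]
  exact lt_of_le_of_lt (ENNReal.inv_mul_le_one _) ENNReal.one_lt_top

theorem isProbabilityMeasure_uniformSphere {n : ℕ} (hn : 1 ≤ n) :
    IsProbabilityMeasure (uniformSphere n) := by
  have : Nonempty (Fin n) := ⟨⟨0, hn⟩⟩
  unfold uniformSphere
  constructor
  simp only [Measure.smul_apply, smul_eq_mul]
  refine ENNReal.inv_mul_cancel ?_ (measure_ne_top _ _)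
  rw [ne_eq, Measure.measure_univ_eq_zero]
  exact Measure.toSphere_ne_zero _

/-- The isometry of `ℂ^n` defined by a unitary matrix. -/
noncomputable def unitaryIsometry {n : ℕ} {M : Matrix (Fin n) (Fin n) ℂ}
    (hM : M ∈ Matrix.unitaryGroup (Fin n) ℂ) :
    EuclideanSpace ℂ (Fin n) ≃ₗᵢ[ℝ] EuclideanSpace ℂ (Fin n) :=
  let L := Unitary.linearIsometryEquiv
    (⟨Matrix.toEuclideanCLM (𝕜 := ℂ) M, Unitary.map_mem _ hM⟩ :
      unitary (EuclideanSpace ℂ (Fin n) →L[ℂ] EuclideanSpace ℂ (Fin n)))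
  { L.toLinearEquiv.restrictScalars ℝ with norm_map' := L.norm_map }

theorem unitaryIsometry_apply {n : ℕ} {M : Matrix (Fin n) (Fin n) ℂ}
    (hM : M ∈ Matrix.unitaryGroup (Fin n) ℂ) (x : EuclideanSpace ℂ (Fin n)) (i : Fin n) :
    unitaryIsometry hM x i = M.mulVec x i := rfl

theorem map_uniformSphere {n : ℕ} {M : Matrix (Fin n) (Fin n) ℂ}
    (hM : M ∈ Matrix.unitaryGroup (Fin n) ℂ) :
    (uniformSphere n).map (sphereMap (unitaryIsometry hM)) = uniformSphere n := by
  unfold uniformSphere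
  rw [Measure.map_smul, map_toSphere]
  exact (unitaryIsometry hM).measurePreserving

theorem continuous_sphere_coe (n : ℕ) :
    Continuous fun z : UnitSphere n => fun i => (z : EuclideanSpace ℂ (Fin n)) i := by
  fun_prop

theorem integral_comp_sphereMap {n : ℕ} {M : Matrix (Fin n) (Fin n) ℂ}
    (hM : M ∈ Matrix.unitaryGroup (Fin n) ℂ) {g : UnitSphere n → ℂ} (hg : Continuous g) :
    ∫ z, g (sphereMap (unitaryIsometry hM) z) ∂(uniformSphere n) =
      ∫ z, g z ∂(uniformSphere n) := by
  conv_rhs => rw [← map_uniformSphere hM]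
  rw [integral_map (continuous_sphereMap _).aemeasurable hg.aestronglyMeasurable]

theorem integrable_of_continuous_compactSpace {X E : Type*} [TopologicalSpace X] [CompactSpace X]
    [MeasurableSpace X] [OpensMeasurableSpace X] [NormedAddCommGroup E]
    [SecondCountableTopologyEither X E] {μ : Measure X} [IsFiniteMeasure μ] {f : X → E}
    (hf : Continuous f) : Integrable f μ :=
  hf.integrable_of_hasCompactSupport (HasCompactSupport.of_compactSpace f)

theorem sum_normSq_sphere {n : ℕ} (z : UnitSphere n) :
    ∑ i, Complex.normSq ((z : EuclideanSpace ℂ (Fin n)) i) = 1 := by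
  have := EuclideanSpace.norm_sq_eq (z : EuclideanSpace ℂ (Fin n))
  rw [norm_eq_of_mem_sphere] at this
  simp only [Complex.normSq_eq_norm_sq, ← this, one_pow]

/-- No integral over the sphere is computed: the moments of a uniform vector are unitarily
invariant, so the cross contraction is already known. -/
theorem integral_normSq_sum_sq_sphere {n : ℕ} (hn : 1 ≤ n) :
    ∫ z, Complex.normSq (∑ i, (z : EuclideanSpace ℂ (Fin n)) i ^ 2) ∂(uniformSphere n) =
      2 / ((n : ℝ) + 1) := by
  have := isProbabilityMeasure_uniformSphere hn
  have : Nonempty (Fin n) := ⟨⟨0, hn⟩⟩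
  set φ : UnitSphere n → Fin n → ℂ := fun z i => (z : EuclideanSpace ℂ (Fin n)) i with hφ
  have hint (a b c e : Fin n) : Integrable (fun ω => quartic (φ ω) a b c e) (uniformSphere n) :=
    integrable_of_continuous_compactSpace
      ((continuous_quartic a b c e).comp (continuous_sphere_coe n))
  have hT (U : Matrix (Fin n) (Fin n) ℂ) (hU : U ∈ Matrix.unitaryGroup (Fin n) ℂ) :
      TensorInvariant (momentTensor (uniformSphere n) φ) U := by
    refine tensorInvariant_momentTensor hint fun a b c e => ?_
    rw [← integral_comp_sphereMap hU (g := fun z => quartic (φ z) a b c e)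
      ((continuous_quartic a b c e).comp (continuous_sphere_coe n))]
    have (z : UnitSphere n) : φ (sphereMap (unitaryIsometry hU) z) = U.mulVec (φ z) :=
      funext fun i => unitaryIsometry_apply hU z i
    simp only [this]
  have h := unitary_invariant_cross hT (momentTensor_swap_left _ _) (momentTensor_swap_right _ _)
    (sum_momentTensor_self hint fun z => sum_normSq_sphere z)
  rw [sum_momentTensor_cross hint, Fintype.card_fin] at h
  exact Complex.ofReal_injective (h.trans (by push_cast; rfl))

end UniformSphere

/-! ### Moments of a Haar random gate applied to a fixed vector -/

section HaarMoments

variable {ι : Type*} [Fintype ι] [DecidableEq ι] {𝕜 : Type*} [RCLike 𝕜]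

instance isProbabilityMeasure_haarProb : IsProbabilityMeasure (haarProb ι 𝕜) :=
  ⟨Measure.haarMeasure_self (K₀ := (⊤ : TopologicalSpace.PositiveCompacts _))⟩

instance isMulLeftInvariant_haarProb : (haarProb ι 𝕜).IsMulLeftInvariant := by
  unfold haarProb
  infer_instance

theorem sum_normSq_mulVec_unitary {M : Matrix ι ι ℂ} (hM : M ∈ Matrix.unitaryGroup ι ℂ)
    (v : ι → ℂ) : ∑ a, Complex.normSq (M.mulVec v a) = ∑ a, Complex.normSq (v a) := by
  have key (w : ι → ℂ) : ((∑ a, Complex.normSq (w a) : ℝ) : ℂ) = star w ⬝ᵥ w := by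
    simp [dotProduct, Complex.normSq_eq_conj_mul_self]
  have : ((∑ a, Complex.normSq (M.mulVec v a) : ℝ) : ℂ) = (∑ a, Complex.normSq (v a) : ℝ) := by
    rw [key, key, Matrix.star_mulVec, Matrix.dotProduct_mulVec, Matrix.vecMul_vecMul,
      ← Matrix.star_eq_conjTranspose, Matrix.mem_unitaryGroup_iff'.mp hM, Matrix.vecMul_one]
  exact_mod_cast this

theorem map_mem_unitaryGroup {f : 𝕜 →+* ℂ} (hf : ∀ x, f (star x) = star (f x)) {M : Matrix ι ι 𝕜}
    (hM : M ∈ Matrix.unitaryGroup ι 𝕜) : M.map f ∈ Matrix.unitaryGroup ι ℂ := by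
  rw [Matrix.mem_unitaryGroup_iff] at hM ⊢
  have : star (M.map f) = (star M).map f := by
    ext i j
    simp only [Matrix.star_apply, Matrix.map_apply, hf]
  rw [this, ← Matrix.map_mul, hM]
  exact Matrix.map_one f (map_zero f) (map_one f)

theorem continuous_gate_mulVec {f : 𝕜 →+* ℂ} (hf : Continuous f) :
    Continuous fun p : Matrix.unitaryGroup ι 𝕜 × (ι → ℂ) =>
      ((p.1 : Matrix ι ι 𝕜).map f).mulVec p.2 := by
  refine Continuous.matrix_mulVec ?_ continuous_snd
  exact (continuous_subtype_val.comp continuous_fst).matrix_map hf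

theorem integrable_quartic_gate {f : 𝕜 →+* ℂ} (hf : Continuous f) (v : ι → ℂ) (a b c e : ι) :
    Integrable (fun U : Matrix.unitaryGroup ι 𝕜 =>
      quartic (((U : Matrix ι ι 𝕜).map f).mulVec v) a b c e) (haarProb ι 𝕜) :=
  integrable_of_continuous_compactSpace ((continuous_quartic a b c e).comp
    ((continuous_gate_mulVec hf).comp (Continuous.prodMk_left v)))

/-- Left invariance of the Haar measure replaces `U` by `M U`. With `f` the identity of `ℂ` or the
inclusion of `ℝ`, both groups are covered. -/
theorem tensorInvariant_gate {f : 𝕜 →+* ℂ} (hf : Continuous f) (v : ι → ℂ) {M : Matrix ι ι 𝕜}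
    (hM : M ∈ Matrix.unitaryGroup ι 𝕜) :
    TensorInvariant (momentTensor (haarProb ι 𝕜) fun U : Matrix.unitaryGroup ι 𝕜 =>
      ((U : Matrix ι ι 𝕜).map f).mulVec v) (M.map f) := by
  refine tensorInvariant_momentTensor (integrable_quartic_gate hf v) fun a b c e => ?_
  rw [← integral_mul_left_eq_self (fun U : Matrix.unitaryGroup ι 𝕜 =>
    quartic (((U : Matrix ι ι 𝕜).map f).mulVec v) a b c e) ⟨M, hM⟩]
  simp [Matrix.mulVec_mulVec, ← Matrix.map_mul]

end HaarMoments

end MultipartiteGates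

namespace MultipartiteGates

open ComplexConjugate

/-! ### Sums over splittings -/

section Splittings

variable {N : ℕ}

/-- The parts `A` contain the first subsystem and their complements do not, so together they run
once through all subsets except `∅` and the whole set. -/
theorem sum_splittings_add_compl (hN : 0 < N) (g : Finset (Fin N) → ℝ) :
    ∑ A ∈ splittings N, (g A + g Aᶜ) = ∑ A, g A - g ∅ - g Finset.univ := by
  set z : Fin N := ⟨0, hN⟩
  have hz (A : Finset (Fin N)) : (∃ i ∈ A, (i : ℕ) = 0) ↔ z ∈ A := by
    constructor
    · rintro ⟨i, hi, h⟩
      rwa [show z = i from Fin.ext h.symm]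
    · exact fun h => ⟨z, h, rfl⟩
  have hsplit : Finset.univ.filter (fun A : Finset (Fin N) => z ∈ A) =
      insert Finset.univ (splittings N) := by
    ext A
    simp only [splittings, hz, Finset.mem_filter, Finset.mem_univ, true_and, Finset.mem_insert]
    by_cases hA : A = Finset.univ
    · simp [hA]
    · have : Aᶜ.Nonempty := by
        rw [Finset.nonempty_iff_ne_empty, ne_eq, Finset.compl_eq_empty_iff]
        exact hA
      simp [hA, this]
  have huniv : Finset.univ ∉ splittings N := by simp [splittings]
  have h1 := Finset.sum_filter_add_sum_filter_not Finset.univ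
    (fun A : Finset (Fin N) => z ∈ A) g
  have h2 : ∑ A : Finset (Fin N) with z ∉ A, g A = ∑ A : Finset (Fin N) with z ∈ A, g Aᶜ := by
    refine Finset.sum_nbij' compl compl ?_ ?_ ?_ ?_ ?_ <;> simp
  rw [h2, hsplit, Finset.sum_insert huniv, Finset.sum_insert huniv, Finset.compl_univ] at h1
  rw [Finset.sum_add_distrib, ← h1]
  ring

theorem sum_splittings_prod (hN : 0 < N) (x : Fin N → ℝ) :
    ∑ A ∈ splittings N, ((∏ i ∈ A, x i) + ∏ i ∈ Aᶜ, x i) =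
      ∏ i, (x i + 1) - 1 - ∏ i, x i := by
  rw [sum_splittings_add_compl hN fun A => ∏ i ∈ A, x i, Finset.prod_add_one]
  simp

/-- Setting all variables to 1 in `sum_splittings_prod` gives twice the count, `2 ^ N - 2`. -/
theorem card_splittings (hN : 0 < N) : ((splittings N).card : ℝ) = 2 ^ (N - 1) - 1 := by
  have h := sum_splittings_prod hN fun _ => 1
  simp only [Finset.prod_const_one, Finset.sum_const, Finset.prod_const, Finset.card_univ,
    Fintype.card_fin, nsmul_eq_mul] at h
  obtain ⟨n, rfl⟩ : ∃ n, N = n + 1 := ⟨N - 1, by omega⟩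
  rw [pow_succ] at h
  norm_num at h ⊢
  linarith

theorem auxC_eq (hN : 0 < N) (d : Fin N → ℕ) :
    auxC d = ∏ i, ((d i : ℝ) + 1) - 1 - auxD d :=
  sum_splittings_prod hN _

theorem auxB_eq (d : Fin N → ℕ) : auxB d = ∏ i, ((d i : ℝ) + 1) := by
  have (i : Fin N) : (d i : ℝ) + 1 = ∑ e : Fin 2, (d i : ℝ) ^ (e : ℕ) := by
    simp [Fin.sum_univ_two, add_comm]
  simp only [this]
  rw [Finset.prod_univ_sum, Fintype.piFinset_univ]
  rfl

end Splittings

/-! ### The bilinear invariant on product states -/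

section ProductStates

variable {N : ℕ} {d : Fin N → ℕ}

theorem continuous_productState :
    Continuous fun ψ : (i : Fin N) → UnitSphere (d i) => productState ψ := by
  unfold productState
  refine continuous_pi fun x => continuous_finsetProd _ fun i _ => ?_
  exact (continuous_apply (x i)).comp ((continuous_sphere_coe (d i)).comp (continuous_apply i))

theorem sum_normSq_productState (ψ : (i : Fin N) → UnitSphere (d i)) :
    ∑ x, Complex.normSq (productState ψ x) = 1 := by
  simp only [productState, map_prod]
  have := Finset.prod_univ_sum (fun i => (Finset.univ : Finset (Fin (d i))))
    (fun i k => Complex.normSq ((ψ i : EuclideanSpace ℂ (Fin (d i))) k))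
  rw [Fintype.piFinset_univ] at this
  rw [← this]
  simp [sum_normSq_sphere]

theorem normSq_sum_sq_productState (ψ : (i : Fin N) → UnitSphere (d i)) :
    Complex.normSq (∑ x, productState ψ x ^ 2) =
      ∏ i, Complex.normSq (∑ k, (ψ i : EuclideanSpace ℂ (Fin (d i))) k ^ 2) := by
  simp only [productState, ← Finset.prod_pow]
  have := Finset.prod_univ_sum (fun i => (Finset.univ : Finset (Fin (d i))))
    (fun i k => (ψ i : EuclideanSpace ℂ (Fin (d i))) k ^ 2)
  rw [Fintype.piFinset_univ] at this
  rw [← this, map_prod]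

theorem integral_normSq_sum_sq_productState (hd : ∀ i, 1 ≤ d i) :
    ∫ ψ, Complex.normSq (∑ x, productState ψ x ^ 2) ∂(Measure.pi fun i => uniformSphere (d i)) =
      ∏ i, 2 / ((d i : ℝ) + 1) := by
  simp only [normSq_sum_sq_productState]
  rw [integral_fintype_prod_eq_prod (𝕜 := ℝ) fun i (z : UnitSphere (d i)) =>
    Complex.normSq (∑ k, (z : EuclideanSpace ℂ (Fin (d i))) k ^ 2)]
  exact Finset.prod_congr rfl fun i _ => integral_normSq_sum_sq_sphere (hd i)

end ProductStates

/-! ### Averages over gates and product states -/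

section GateAverages

variable {N : ℕ} {d : Fin N → ℕ} {𝕜 : Type*} [RCLike 𝕜]

theorem integral_purity_unitary (hd : ∀ i, 1 ≤ d i) {v : BasisIndex d → ℂ}
    (hv : ∑ a, Complex.normSq (v a) = 1) (A : Finset (Fin N)) :
    ∫ U : Matrix.unitaryGroup (BasisIndex d) ℂ,
      purity A (((U : Matrix (BasisIndex d) (BasisIndex d) ℂ).map (RingHom.id ℂ)).mulVec v)
      ∂(haarProb (BasisIndex d) ℂ) =
    ((∏ i ∈ A, (d i : ℝ)) + ∏ i ∈ Aᶜ, (d i : ℝ)) / (auxD d + 1) := by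
  have : Nonempty (BasisIndex d) := ⟨fun i => ⟨0, hd i⟩⟩
  have hf : Continuous (RingHom.id ℂ) := continuous_id
  have hint := integrable_quartic_gate (ι := BasisIndex d) hf v
  rw [integral_purity hint, unitary_invariant_bipartite (fun U hU => tensorInvariant_gate hf v hU)
    (momentTensor_swap_left _ _) (momentTensor_swap_right _ _)
    (sum_momentTensor_self hint fun U => ?_) (splitEquiv d A)]
  · rw [← card_subIndex, ← card_subIndex_compl, ← card_basisIndex, ← Complex.ofReal_re (_ / _)]
    push_cast
    rfl
  · rw [sum_normSq_mulVec_unitary (map_mem_unitaryGroup (fun _ => rfl) U.2), hv]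

theorem integral_purity_orthogonal (hD : 2 ≤ Fintype.card (BasisIndex d)) {v : BasisIndex d → ℂ}
    (hv : ∑ a, Complex.normSq (v a) = 1) (A : Finset (Fin N)) :
    ∫ O : Matrix.orthogonalGroup (BasisIndex d) ℝ,
      purity A (((O : Matrix (BasisIndex d) (BasisIndex d) ℝ).map Complex.ofRealHom).mulVec v)
      ∂(haarProb (BasisIndex d) ℝ) =
    (Complex.normSq (∑ a, v a ^ 2) * (auxD d + 1) - 2 + (auxD d - Complex.normSq (∑ a, v a ^ 2)) *
      ((∏ i ∈ A, (d i : ℝ)) + ∏ i ∈ Aᶜ, (d i : ℝ))) / ((auxD d - 1) * (auxD d + 2)) := by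
  have hf : Continuous Complex.ofRealHom := Complex.continuous_ofReal
  have hint := integrable_quartic_gate (ι := BasisIndex d) hf v
  -- `∑ w_a²` is `w ⬝ᵥ w` without conjugation, preserved because the transpose of `O` is its
  -- inverse.
  have hs (O : Matrix.orthogonalGroup (BasisIndex d) ℝ) :
      ∑ a, ((O : Matrix (BasisIndex d) (BasisIndex d) ℝ).map Complex.ofRealHom).mulVec v a ^ 2 =
        ∑ a, v a ^ 2 := by
    have key (w : BasisIndex d → ℂ) : ∑ a, w a ^ 2 = w ⬝ᵥ w := by simp [dotProduct, sq]
    have hO := Matrix.mem_unitaryGroup_iff'.mp O.2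
    rw [Matrix.star_eq_conjTranspose, Matrix.conjTranspose_eq_transpose_of_trivial] at hO
    rw [key, key, Matrix.dotProduct_mulVec, ← Matrix.mulVec_transpose, Matrix.mulVec_mulVec,
      ← Matrix.transpose_map, ← Matrix.map_mul, hO, Matrix.map_one _ (map_zero _) (map_one _),
      Matrix.one_mulVec]
  rw [integral_purity hint, orthogonal_invariant_bipartite
    (fun O hO => tensorInvariant_gate hf v hO)
    (momentTensor_swap_left _ _) (momentTensor_swap_right _ _)
    (sum_momentTensor_self hint fun O => ?_) (sum_momentTensor_cross hint) hD (splitEquiv d A)]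
  · simp only [hs, integral_const, probReal_univ, one_smul]
    rw [← card_subIndex, ← card_subIndex_compl, ← card_basisIndex, ← Complex.ofReal_re (_ / _)]
    push_cast
    rfl
  · rw [sum_normSq_mulVec_unitary (map_mem_unitaryGroup (fun x => (Complex.conj_ofReal x).symm) O.2),
      hv]

theorem oneTangle_eq (hN : 2 ≤ N) (φ : BasisIndex d → ℂ) :
    oneTangle φ = 2 * (1 - (∑ A ∈ splittings N, purity A φ) / (2 ^ (N - 1) - 1)) := by
  have h1 : (1 : ℝ) < 2 ^ (N - 1) := one_lt_pow₀ one_lt_two (by omega)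
  have h2 : (2 : ℝ) ^ (N - 1) - 1 ≠ 0 := by linarith
  simp only [oneTangle, concurrence_eq, ← Finset.mul_sum, Finset.sum_sub_distrib,
    Finset.sum_const, nsmul_eq_mul, mul_one, card_splittings (show 0 < N by omega)]
  field_simp

theorem continuous_oneTangle : Continuous fun φ : BasisIndex d → ℂ => oneTangle φ := by
  unfold oneTangle
  simp only [concurrence_eq]
  exact continuous_const.mul (continuous_finsetSum _ fun A _ =>
    continuous_const.mul (continuous_const.sub (continuous_purity A)))

/-- Fubini for a continuous function on a compact product; the gate can then be averaged with the
input fixed. -/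
theorem integral_entanglingPower {f : 𝕜 →+* ℂ} (hf : Continuous f) :
    ∫ U : Matrix.unitaryGroup (BasisIndex d) 𝕜,
      entanglingPower ((U : Matrix (BasisIndex d) (BasisIndex d) 𝕜).map f)
      ∂(haarProb (BasisIndex d) 𝕜) =
    ∫ ψ, ∫ U : Matrix.unitaryGroup (BasisIndex d) 𝕜,
      oneTangle (((U : Matrix (BasisIndex d) (BasisIndex d) 𝕜).map f).mulVec (productState ψ))
      ∂(haarProb (BasisIndex d) 𝕜) ∂(Measure.pi fun i => uniformSphere (d i)) := by
  have h1 : Continuous fun p : Matrix.unitaryGroup (BasisIndex d) 𝕜 ×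
      ((i : Fin N) → UnitSphere (d i)) => (p.1, productState p.2) :=
    continuous_fst.prodMk (continuous_productState.comp continuous_snd)
  have h2 := continuous_oneTangle.comp ((continuous_gate_mulVec (ι := BasisIndex d) hf).comp h1)
  simp only [Function.comp_def] at h2
  have h3 : Integrable (fun p : Matrix.unitaryGroup (BasisIndex d) 𝕜 ×
      ((i : Fin N) → UnitSphere (d i)) => oneTangle
        (((p.1 : Matrix (BasisIndex d) (BasisIndex d) 𝕜).map f).mulVec (productState p.2)))
      ((haarProb (BasisIndex d) 𝕜).prod (Measure.pi fun i => uniformSphere (d i))) :=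
    integrable_of_continuous_compactSpace h2
  exact integral_integral_swap (f := fun (U : Matrix.unitaryGroup (BasisIndex d) 𝕜)
    (ψ : (i : Fin N) → UnitSphere (d i)) => oneTangle
      (((U : Matrix (BasisIndex d) (BasisIndex d) 𝕜).map f).mulVec (productState ψ))) h3

theorem integral_oneTangle (hN : 2 ≤ N) {f : 𝕜 →+* ℂ} (hf : Continuous f) (v : BasisIndex d → ℂ) :
    ∫ U : Matrix.unitaryGroup (BasisIndex d) 𝕜,
      oneTangle (((U : Matrix (BasisIndex d) (BasisIndex d) 𝕜).map f).mulVec v)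
      ∂(haarProb (BasisIndex d) 𝕜) =
    2 * (1 - (∑ A ∈ splittings N, ∫ U : Matrix.unitaryGroup (BasisIndex d) 𝕜,
      purity A (((U : Matrix (BasisIndex d) (BasisIndex d) 𝕜).map f).mulVec v)
      ∂(haarProb (BasisIndex d) 𝕜)) / (2 ^ (N - 1) - 1)) := by
  have hint (A : Finset (Fin N)) : Integrable (fun U : Matrix.unitaryGroup (BasisIndex d) 𝕜 =>
      purity A (((U : Matrix (BasisIndex d) (BasisIndex d) 𝕜).map f).mulVec v))
      (haarProb (BasisIndex d) 𝕜) :=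
    integrable_of_continuous_compactSpace ((continuous_purity A).comp
      ((continuous_gate_mulVec hf).comp (Continuous.prodMk_left v)))
  simp only [oneTangle_eq hN]
  rw [integral_const_mul, integral_sub (integrable_const _)
    ((integrable_finsetSum _ fun A _ => hint A).div_const _), integral_div,
    integral_finsetSum _ fun A _ => hint A]
  simp

theorem averageUnitary_eq (hN : 2 ≤ N) (hd : ∀ i, 1 ≤ d i) :
    averageUnitary d = 2 * (1 - auxC d / ((2 ^ (N - 1) - 1) * (auxD d + 1))) := by
  have (i : Fin N) := isProbabilityMeasure_uniformSphere (hd i)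
  have h := integral_entanglingPower (d := d) (f := RingHom.id ℂ) continuous_id
  simp only [integral_oneTangle hN (f := RingHom.id ℂ) continuous_id,
    integral_purity_unitary hd (sum_normSq_productState _), integral_const, probReal_univ,
    one_smul, ← Finset.sum_div] at h
  rw [averageUnitary, mul_comm (_ - _), ← div_div, auxC]
  exact h

theorem averageOrthogonal_eq (hN : 2 ≤ N) (hd : ∀ i, 1 ≤ d i) (hd' : ∃ i, 2 ≤ d i) :
    averageOrthogonal d = 2 * (1 - ((∏ i, 2 / ((d i : ℝ) + 1)) * (auxD d + 1) - 2 +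
      (auxD d - ∏ i, 2 / ((d i : ℝ) + 1)) * (auxC d / (2 ^ (N - 1) - 1))) /
        ((auxD d - 1) * (auxD d + 2))) := by
  have (i : Fin N) := isProbabilityMeasure_uniformSphere (hd i)
  have h1 : (1 : ℝ) < 2 ^ (N - 1) := one_lt_pow₀ one_lt_two (by omega)
  have h2 : (2 : ℝ) ^ (N - 1) - 1 ≠ 0 := by linarith
  have hD : 2 ≤ Fintype.card (BasisIndex d) := by
    obtain ⟨i, hi⟩ := hd'
    simp only [Fintype.card_pi, Fintype.card_fin]
    exact hi.trans (Nat.le_of_dvd (Finset.prod_pos fun i _ => hd i)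
      (Finset.dvd_prod_of_mem _ (Finset.mem_univ i)))
  have hsum (s : ℝ) : (∑ A ∈ splittings N, (s * (auxD d + 1) - 2 + (auxD d - s) *
      ((∏ i ∈ A, (d i : ℝ)) + ∏ i ∈ Aᶜ, (d i : ℝ))) / ((auxD d - 1) * (auxD d + 2))) /
        (2 ^ (N - 1) - 1) =
      (s * (auxD d + 1) - 2 + (auxD d - s) * (auxC d / (2 ^ (N - 1) - 1))) /
        ((auxD d - 1) * (auxD d + 2)) := by
    rw [← Finset.sum_div, Finset.sum_add_distrib, ← Finset.mul_sum, Finset.sum_const,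
      nsmul_eq_mul, card_splittings (by omega), div_right_comm, ← auxC]
    congr 1
    field_simp
  have h := integral_entanglingPower (d := d) (f := Complex.ofRealHom) Complex.continuous_ofReal
  simp only [integral_oneTangle hN (f := Complex.ofRealHom) Complex.continuous_ofReal] at h
  have h3 (ψ : (i : Fin N) → UnitSphere (d i)) (A : Finset (Fin N)) :=
    integral_purity_orthogonal hD (sum_normSq_productState ψ) A
  simp only [Matrix.orthogonalGroup] at h3
  simp only [h3, hsum] at h
  -- The gate average is affine in `s`, so integrating over product states replaces `s` by its mean.
  obtain ⟨p, q, hpq⟩ : ∃ p q : ℝ, ∀ s : ℝ, 2 * (1 - (s * (auxD d + 1) - 2 +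
      (auxD d - s) * (auxC d / (2 ^ (N - 1) - 1))) / ((auxD d - 1) * (auxD d + 2))) =
      p - q * s :=
    ⟨2 * (1 - (auxD d * (auxC d / (2 ^ (N - 1) - 1)) - 2) / ((auxD d - 1) * (auxD d + 2))),
      2 * (auxD d + 1 - auxC d / (2 ^ (N - 1) - 1)) / ((auxD d - 1) * (auxD d + 2)),
      fun s => by ring⟩
  simp only [hpq] at h ⊢
  have hcont : Continuous fun ψ : (i : Fin N) → UnitSphere (d i) =>
      Complex.normSq (∑ x, productState ψ x ^ 2) :=
    Complex.continuous_normSq.comp (continuous_finsetSum _ fun x _ =>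
      ((continuous_apply x).comp continuous_productState).pow 2)
  rw [integral_sub (integrable_const _)
    ((integrable_of_continuous_compactSpace hcont).const_mul _), integral_const_mul,
    integral_normSq_sum_sq_productState hd] at h
  simp only [integral_const, probReal_univ, one_smul] at h
  exact h

end GateAverages

end MultipartiteGates

namespace MultipartiteGates

/-! ### Closed forms -/

section EqualDimensions

variable {N : ℕ} {d : Fin N → ℕ}

theorem auxB_pos (d : Fin N → ℕ) : 0 < auxB d := by
  rw [auxB_eq]
  exact Finset.prod_pos fun i _ => by positivity

theorem prod_two_div_add_one (d : Fin N → ℕ) :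
    ∏ i, 2 / ((d i : ℝ) + 1) = 2 ^ N / auxB d := by
  rw [auxB_eq, Finset.prod_div_distrib]
  simp

theorem prod_one_div_add_one (d : Fin N → ℕ) :
    ∏ i, 1 / ((d i : ℝ) + 1) = 1 / auxB d := by
  rw [auxB_eq, Finset.prod_div_distrib]
  simp

theorem auxC_eq_auxB (hN : 0 < N) (d : Fin N → ℕ) : auxC d = auxB d - 1 - auxD d := by
  rw [auxC_eq hN, auxB_eq]

theorem two_le_auxD (hd : ∀ i, 1 ≤ d i) (hd' : ∃ i, 2 ≤ d i) : 2 ≤ auxD d := by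
  obtain ⟨i, hi⟩ := hd'
  have : 2 ≤ ∏ i, d i := hi.trans (Nat.le_of_dvd (Finset.prod_pos fun i _ => hd i)
    (Finset.dvd_prod_of_mem _ (Finset.mem_univ i)))
  unfold auxD
  exact_mod_cast this

theorem two_pow_pred_sub_one_pos (hN : 2 ≤ N) : (0 : ℝ) < 2 ^ (N - 1) - 1 :=
  sub_pos.mpr (one_lt_pow₀ one_lt_two (by omega))

theorem two_mul_two_pow_pred (hN : 2 ≤ N) : (2 : ℝ) ^ N = 2 * (2 ^ (N - 1) - 1) + 2 := by
  obtain ⟨n, rfl⟩ : ∃ n, N = n + 1 := ⟨N - 1, by omega⟩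
  rw [pow_succ, Nat.add_sub_cancel]
  ring

theorem averageUnitary_closed_form (hN : 2 ≤ N) (hd : ∀ i, 1 ≤ d i) :
    averageUnitary d = (2 ^ N * (auxD d + 1) - 2 * auxB d) /
      ((2 ^ (N - 1) - 1) * (auxD d + 1)) := by
  have h1 := two_pow_pred_sub_one_pos hN
  have h2 : 0 ≤ auxD d := Finset.prod_nonneg fun i _ => Nat.cast_nonneg _
  rw [averageUnitary_eq hN hd, auxC_eq_auxB (by omega), two_mul_two_pow_pred hN]
  have h3 : auxD d + 1 ≠ 0 := by linarith
  have h4 := h1.ne'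
  -- Since `2 ^ N` has become `2 * h + 2`, only a rational identity in `h`, `B`, `D` remains.
  generalize (2 : ℝ) ^ (N - 1) - 1 = h at *
  field_simp
  ring

/-- Substituting `C = B - 1 - D` makes the numerator factor, for arbitrary local dimensions; one
factor is the numerator of the unitary average. -/
theorem averageOrthogonal_closed_form (hN : 2 ≤ N) (hd : ∀ i, 1 ≤ d i) (hd' : ∃ i, 2 ≤ d i) :
    averageOrthogonal d = ((2 ^ N * (auxD d + 1) - 2 * auxB d) * (auxD d * auxB d - 2 ^ N)) /
      ((2 ^ (N - 1) - 1) * (auxD d ^ 2 + auxD d - 2) * auxB d) := by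
  have h1 := two_pow_pred_sub_one_pos hN
  have h2 := two_le_auxD hd hd'
  have h5 := (auxB_pos d).ne'
  rw [averageOrthogonal_eq hN hd hd', auxC_eq_auxB (by omega), prod_two_div_add_one,
    two_mul_two_pow_pred hN, show auxD d ^ 2 + auxD d - 2 = (auxD d - 1) * (auxD d + 2) by ring]
  have h3 : auxD d - 1 ≠ 0 := by linarith
  have h3' : auxD d + 2 ≠ 0 := by linarith
  have h4 := h1.ne'
  generalize (2 : ℝ) ^ (N - 1) - 1 = h at *
  field_simp
  ring

theorem auxD_const (d N : ℕ) : auxD (fun _ : Fin N => d) = (d : ℝ) ^ N := by simp [auxD]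

theorem auxB_const (d N : ℕ) : auxB (fun _ : Fin N => d) = ((d : ℝ) + 1) ^ N := by
  simp [auxB_eq]

end EqualDimensions

/-! ### Many subsystems -/

section Limits

/-- Numerator and denominator are divided by `2 ^ N * d ^ N`, so that `N` enters only through powers
of numbers in `(0, 1)`. -/
theorem averageUnitary_const {d N : ℕ} (hd : 2 ≤ d) (hN : 2 ≤ N) :
    averageUnitary (fun _ : Fin N => d) =
      (1 + (1 / (d : ℝ)) ^ N - 2 * (((d : ℝ) + 1) / (2 * d)) ^ N) /
        ((1 / 2 - (1 / 2 : ℝ) ^ N) * (1 + (1 / (d : ℝ)) ^ N)) := by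
  have h1 := two_pow_pred_sub_one_pos hN
  have h2 := two_mul_two_pow_pred hN
  have hd0 : (0 : ℝ) < d := by exact_mod_cast (by omega : 0 < d)
  have hD : (0 : ℝ) < (d : ℝ) ^ N := by positivity
  have hP : (0 : ℝ) < 2 ^ N := by positivity
  rw [averageUnitary_closed_form hN (fun _ => by omega), auxD_const, auxB_const]
  simp only [div_pow, mul_pow, one_pow]
  generalize (2 : ℝ) ^ (N - 1) - 1 = h at *
  generalize (2 : ℝ) ^ N = P at *
  generalize (d : ℝ) ^ N = D at *
  generalize ((d : ℝ) + 1) ^ N = B at *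
  obtain rfl : h = P / 2 - 1 := by linarith
  have e1 : 1 / 2 - 1 / P = (P / 2 - 1) / P := by field_simp
  have e2 : 1 + 1 / D = (D + 1) / D := by field_simp
  have e3 : (D + 1) / D - 2 * (B / (P * D)) = (P * (D + 1) - 2 * B) / (P * D) := by field_simp
  rw [e1, e2, e3, div_mul_div_comm, div_div_div_cancel_right₀ (by positivity)]

/-- The ratio of the two averages is written in powers that tend to 0, so it tends to 1. -/
theorem averageOrthogonal_const {d N : ℕ} (hd : 2 ≤ d) (hN : 2 ≤ N) :
    averageOrthogonal (fun _ : Fin N => d) = averageUnitary (fun _ : Fin N => d) *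
      (((1 - (2 / ((d : ℝ) + 1)) ^ N * (1 / (d : ℝ)) ^ N) * (1 + (1 / (d : ℝ)) ^ N)) /
        ((1 - (1 / (d : ℝ)) ^ N) * (1 + 2 * (1 / (d : ℝ)) ^ N))) := by
  have h1 := two_pow_pred_sub_one_pos hN
  have h3 := two_le_auxD (d := fun _ : Fin N => d) (fun _ => by omega) ⟨⟨0, by omega⟩, hd⟩
  have hB : (0 : ℝ) < ((d : ℝ) + 1) ^ N := by positivity
  rw [averageUnitary_closed_form hN (fun _ => by omega),
    averageOrthogonal_closed_form hN (fun _ => by omega) ⟨⟨0, by omega⟩, hd⟩]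
  rw [auxD_const] at *
  rw [auxB_const]
  simp only [div_pow, one_pow]
  generalize (2 : ℝ) ^ (N - 1) - 1 = h at *
  generalize (2 : ℝ) ^ N = P at *
  generalize (d : ℝ) ^ N = D at *
  generalize ((d : ℝ) + 1) ^ N = B at *
  have hD : 0 < D := by linarith
  have hD1 : D - 1 ≠ 0 := by linarith
  have hD2 : D + 2 ≠ 0 := by linarith
  have hD3 : D + 1 ≠ 0 := by linarith
  have e1 : 1 - P / B * (1 / D) = (D * B - P) / (D * B) := by field_simp
  have e2 : 1 + 1 / D = (D + 1) / D := by field_simp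
  have e3 : 1 - 1 / D = (D - 1) / D := by field_simp
  have e4 : 1 + 2 * (1 / D) = (D + 2) / D := by field_simp
  rw [e1, e2, e3, e4, show D ^ 2 + D - 2 = (D - 1) * (D + 2) by ring]
  field_simp

theorem tendsto_inv_pow {d : ℕ} (hd : 2 ≤ d) :
    Tendsto (fun N : ℕ => (1 / (d : ℝ)) ^ N) atTop (𝓝 0) := by
  have hd2 : (2 : ℝ) ≤ d := by exact_mod_cast hd
  refine tendsto_pow_atTop_nhds_zero_of_lt_one (by positivity) ?_
  rw [div_lt_one (by linarith)]
  linarith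

theorem tendsto_averageUnitary {d : ℕ} (hd : 2 ≤ d) :
    Tendsto (fun N : ℕ => averageUnitary (fun _ : Fin N => d)) atTop (𝓝 2) := by
  have hd2 : (2 : ℝ) ≤ d := by exact_mod_cast hd
  have t1 : Tendsto (fun N : ℕ => (((d : ℝ) + 1) / (2 * d)) ^ N) atTop (𝓝 0) := by
    refine tendsto_pow_atTop_nhds_zero_of_lt_one (by positivity) ?_
    -- The base is below 1 because `d ≥ 2` gives `d + 1 < 2 * d`.
    rw [div_lt_one (by linarith)]
    linarith
  have t2 := tendsto_inv_pow hd
  have t3 : Tendsto (fun N : ℕ => (1 / 2 : ℝ) ^ N) atTop (𝓝 0) :=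
    tendsto_pow_atTop_nhds_zero_of_lt_one (by norm_num) (by norm_num)
  have t := ((t2.const_add 1).sub (t1.const_mul 2)).div
    ((t3.const_sub (1 / 2)).mul (t2.const_add 1)) (by norm_num)
  rw [show ((1 : ℝ) + 0 - 2 * 0) / ((1 / 2 - 0) * (1 + 0)) = 2 by norm_num] at t
  refine t.congr' ?_
  -- For `N < 2` there are no splittings and `2 ^ (N - 1) - 1 = 0`, so the closed forms are used
  -- only from `N = 2` on.
  filter_upwards [eventually_ge_atTop 2] with N hN
  exact (averageUnitary_const hd hN).symm

theorem tendsto_averageOrthogonal {d : ℕ} (hd : 2 ≤ d) :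
    Tendsto (fun N : ℕ => averageOrthogonal (fun _ : Fin N => d)) atTop (𝓝 2) := by
  have hd2 : (2 : ℝ) ≤ d := by exact_mod_cast hd
  have t1 : Tendsto (fun N : ℕ => (2 / ((d : ℝ) + 1)) ^ N) atTop (𝓝 0) := by
    refine tendsto_pow_atTop_nhds_zero_of_lt_one (by positivity) ?_
    rw [div_lt_one (by linarith)]
    linarith
  have t2 := tendsto_inv_pow hd
  have t := (tendsto_averageUnitary hd).mul ((((t1.mul t2).const_sub 1).mul (t2.const_add 1)).div
    ((t2.const_sub 1).mul ((t2.const_mul 2).const_add 1)) (by norm_num))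
  rw [show (2 : ℝ) * (((1 - 0 * 0) * (1 + 0)) / ((1 - 0) * (1 + 2 * 0))) = 2 by norm_num] at t
  refine t.congr' ?_
  filter_upwards [eventually_ge_atTop 2] with N hN
  exact (averageOrthogonal_const hd hN).symm

end Limits

end MultipartiteGates

theorem mainTheorem3 :
    -- arbitrary local dimensions
    (∀ (N : ℕ) (d : Fin N → ℕ), 2 ≤ N → (∀ i, 1 ≤ d i) →
      ((∃ i, 2 ≤ d i) →
        MultipartiteGates.averageOrthogonal d =
          2 * (1 - (∏ i, 1 / ((d i : ℝ) + 1)) *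
            ((2 ^ N * (MultipartiteGates.auxD d + 1) - 2 * MultipartiteGates.auxB d
                + (MultipartiteGates.auxB d * MultipartiteGates.auxD d - 2 ^ N)
                    / (2 ^ (N - 1) - 1) * MultipartiteGates.auxC d)
              / ((MultipartiteGates.auxD d - 1) * (MultipartiteGates.auxD d + 2))))) ∧
      MultipartiteGates.averageUnitary d =
        2 * (1 - (∏ i, 1 / ((d i : ℝ) + 1)) *
          (MultipartiteGates.auxB d * MultipartiteGates.auxC d
            / ((2 ^ (N - 1) - 1) * (MultipartiteGates.auxD d + 1))))) ∧
    -- equal local dimensions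
    (∀ (d N : ℕ), 2 ≤ d → 2 ≤ N →
      MultipartiteGates.averageOrthogonal (fun _ : Fin N => d) =
        ((2 ^ N * ((d : ℝ) ^ N + 1) - 2 * ((d : ℝ) + 1) ^ N)
            * ((d : ℝ) ^ N * ((d : ℝ) + 1) ^ N - 2 ^ N))
          / ((2 ^ (N - 1) - 1) * ((d : ℝ) ^ (2 * N) + (d : ℝ) ^ N - 2) * ((d : ℝ) + 1) ^ N) ∧
      MultipartiteGates.averageUnitary (fun _ : Fin N => d) =
        (2 ^ N * ((d : ℝ) ^ N + 1) - 2 * ((d : ℝ) + 1) ^ N)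
          / ((2 ^ (N - 1) - 1) * ((d : ℝ) ^ N + 1))) ∧
    -- the limit of many subsystems
    (∀ d : ℕ, 2 ≤ d →
      Tendsto (fun N : ℕ => MultipartiteGates.averageOrthogonal (fun _ : Fin N => d))
        atTop (𝓝 2) ∧
      Tendsto (fun N : ℕ => MultipartiteGates.averageUnitary (fun _ : Fin N => d))
        atTop (𝓝 2)) := by
  refine ⟨fun N d hN hd => ⟨fun hd' => ?_, ?_⟩, fun d N hd hN => ⟨?_, ?_⟩, fun d hd =>
    ⟨MultipartiteGates.tendsto_averageOrthogonal hd, MultipartiteGates.tendsto_averageUnitary hd⟩⟩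
  -- The prefactor is `1 / B` and the mean of `s` is `2 ^ N / B`; clearing `B` matches the stated
  -- form.
  · have hB := (MultipartiteGates.auxB_pos d).ne'
    have h1 := (MultipartiteGates.two_pow_pred_sub_one_pos hN).ne'
    rw [MultipartiteGates.averageOrthogonal_eq hN hd hd', MultipartiteGates.prod_two_div_add_one,
      MultipartiteGates.prod_one_div_add_one, ← mul_div_assoc]
    congr 3
    field_simp
  · have hB := (MultipartiteGates.auxB_pos d).ne'
    rw [MultipartiteGates.averageUnitary_eq hN hd, MultipartiteGates.prod_one_div_add_one]
    congr 2
    field_simp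
  · rw [MultipartiteGates.averageOrthogonal_closed_form hN (fun _ => by omega)
      ⟨⟨0, by omega⟩, hd⟩, MultipartiteGates.auxD_const, MultipartiteGates.auxB_const,
      ← pow_mul, mul_comm N 2]
  · rw [MultipartiteGates.averageUnitary_closed_form hN (fun _ => by omega),
      MultipartiteGates.auxD_const, MultipartiteGates.auxB_const]
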